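/- Let $d\ge 0$ be an integer, $L\ge 0$ and $\gamma$ real numbers, and let $f:\mathbb{R}^d\to\mathbb{R}$ be three times differentiable. Assume that $f$ is $L$-smooth, i.e. $-L\,\mathbb{I}_d\preceq\nabla^2 f(x)\preceq L\,\mathbb{I}_d$ for all $x\in\mathbb{R}^d$, and $\gamma L^{3/2}$-strongly Hessian Lipschitz, i.e. for all $x\in\mathbb{R}^d$ $$\|\nabla^3 f(x)\|_{\{1,2\}\{3\}}:=\sup\Big\{\sum_{i,j,k=1}^d \partial_i\partial_j\partial_k f(x)\,X_{ij}\,y_k \;:\; \sum_{i,j}X_{ij}^2\le 1,\ \sum_k y_k^2\le 1\Big\}\le \gamma L^{3/2}.$$ Let $K\ge 1$ be an integer and $\eta>0$ a step-size with $K\eta L^{1/2}\le \frac14$. For $q_0\in\mathbb{R}^d$ let $\mathcal{P}_{q_0}$ be the HMC proposal distribution at $q_0$: the law of $q_K$, where $p_0\sim\mathcal{N}(0,\mathbb{I}_d)$ and, for $k=0,\dots,K-1$, $$p_{k+\frac12}=p_k-\tfrac{\eta}{2}\nabla f(q_k),\qquad q_{k+1}=q_k+\eta\,p_{k+\frac12},\qquad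 p_{k+1}=p_{k+\frac12}-\tfrac{\eta}{2}\nabla f(q_{k+1}).$$ Then for all $q_0,\tilde q_0\in\mathbb{R}^d$ with $\|q_0-\tilde q_0\|\le\frac{1}{64}K\eta$ (Euclidean norm), $$\mathrm{KL}\big(\mathcal{P}_{q_0}\,\|\,\mathcal{P}_{\tilde q_0}\big)\le\frac1{64}+\frac14K^6\eta^6\gamma^2L^3$$ and $$\sup_{A\subseteq\mathbb{R}^d\text{ Borel}}\big|\mathcal{P}_{q_0}(A)-\mathcal{P}_{\tilde q_0}(A)\big|\le\Big(\frac1{32}+\frac12K^6\eta^6\gamma^2L^3\Big)^{1/2}.$$ -/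

import Mathlib

open MeasureTheory

noncomputable section

/-- The state space `ℝ^d` with its Euclidean norm. -/
abbrev Vec (d : ℕ) : Type := EuclideanSpace ℝ (Fin d)

/-- `f` is twice differentiable and `-L I ⪯ ∇²f(x) ⪯ L I` for all `x`, the Loewner bounds being
written through the quadratic form of the second derivative. For the symmetric matrix `∇²f(x)` this
says that its spectral norm is at most `L`. -/
structure LSmooth {d : ℕ} (L : ℝ) (f : Vec d → ℝ) : Prop where
  differentiable : Differentiable ℝ f
  differentiable_fderiv : Differentiable ℝ (fderiv ℝ f)
  hessian_le : ∀ x v : Vec d, fderiv ℝ (fderiv ℝ f) x v v ≤ L * ‖v‖ ^ 2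
  neg_le_hessian : ∀ x v : Vec d, -(L * ‖v‖ ^ 2) ≤ fderiv ℝ (fderiv ℝ f) x v v

/-- The array of third partial derivatives `∂³f / ∂x_i ∂x_j ∂x_k` at `x`. -/
def thirdDerivTensor {d : ℕ} (f : Vec d → ℝ) (x : Vec d) (i j k : Fin d) : ℝ :=
  fderiv ℝ (fderiv ℝ (fderiv ℝ f)) x (EuclideanSpace.single i 1) (EuclideanSpace.single j 1)
    (EuclideanSpace.single k 1)

/-- The set of values `∑ A_{ijk} X_{ij} y_k` over `∑ X_{ij}² ≤ 1` and `∑ y_k² ≤ 1`. -/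
def pairSingleValues {d : ℕ} (A : Fin d → Fin d → Fin d → ℝ) : Set ℝ :=
  {r | ∃ (X : Fin d → Fin d → ℝ) (y : Fin d → ℝ),
    ∑ i, ∑ j, X i j ^ 2 ≤ 1 ∧ ∑ k, y k ^ 2 ≤ 1 ∧
      r = ∑ i, ∑ j, ∑ k, A i j k * X i j * y k}

/-- The `{1,2}{3}`-norm of a 3-tensor. -/
def pairSingleNorm {d : ℕ} (A : Fin d → Fin d → Fin d → ℝ) : ℝ :=
  sSup (pairSingleValues A)

/-- The supremum defining the `{1,2}{3}`-norm is over a nonempty set. -/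
theorem pairSingleValues_nonempty {d : ℕ} (A : Fin d → Fin d → Fin d → ℝ) :
    (pairSingleValues A).Nonempty :=
  ⟨0, 0, 0, by simp, by simp, by simp⟩

/-- The supremum defining the `{1,2}{3}`-norm is over a bounded set. -/
theorem pairSingleValues_bddAbove {d : ℕ} (A : Fin d → Fin d → Fin d → ℝ) :
    BddAbove (pairSingleValues A) := by
  refine ⟨∑ i, ∑ j, ∑ k, |A i j k|, ?_⟩
  rintro r ⟨X, y, hX, hy, rfl⟩
  refine Finset.sum_le_sum fun i _ => Finset.sum_le_sum fun j _ => Finset.sum_le_sum fun k _ => ?_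
  have h1 : X i j ^ 2 ≤ 1 := by
    refine le_trans ?_ hX
    refine le_trans ?_ (Finset.single_le_sum (f := fun i => ∑ j, X i j ^ 2)
      (fun i _ => Finset.sum_nonneg fun j _ => sq_nonneg _) (Finset.mem_univ i))
    exact Finset.single_le_sum (f := fun j => X i j ^ 2) (fun j _ => sq_nonneg _)
      (Finset.mem_univ j)
  have h2 : y k ^ 2 ≤ 1 :=
    le_trans (Finset.single_le_sum (f := fun k => y k ^ 2) (fun j _ => sq_nonneg _)
      (Finset.mem_univ k)) hy
  have h1' : |X i j| ≤ 1 := (sq_le_one_iff_abs_le_one _).1 h1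
  have h2' : |y k| ≤ 1 := (sq_le_one_iff_abs_le_one _).1 h2
  calc A i j k * X i j * y k ≤ |A i j k * X i j * y k| := le_abs_self _
    _ = |A i j k| * (|X i j| * |y k|) := by rw [abs_mul, abs_mul, mul_assoc]
    _ ≤ |A i j k| * 1 := by
        gcongr
        exact mul_le_one₀ h1' (abs_nonneg _) h2'
    _ = |A i j k| := mul_one _

/-- `f` is thrice differentiable and the `{1,2}{3}`-norm of its third derivative is everywhere at
most `M`. -/
structure StronglyHessianLipschitz {d : ℕ} (M : ℝ) (f : Vec d → ℝ) : Prop where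
  differentiable : Differentiable ℝ f
  differentiable_fderiv : Differentiable ℝ (fderiv ℝ f)
  differentiable_fderiv_fderiv : Differentiable ℝ (fderiv ℝ (fderiv ℝ f))
  norm_le : ∀ x : Vec d, pairSingleNorm (thirdDerivTensor f x) ≤ M

/-- One leapfrog step of size `η` for the Hamiltonian `f(q) + ‖p‖² / 2`. -/
def leapfrogStep {d : ℕ} (f : Vec d → ℝ) (η : ℝ) (z : Vec d × Vec d) : Vec d × Vec d :=
  let pHalf := z.2 - (η / 2) • gradient f z.1
  let qNew := z.1 + η • pHalf
  (qNew, pHalf - (η / 2) • gradient f qNew)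

/-- The forward map `(q₀, p₀) ↦ (q_k, p_k)` of `k` leapfrog steps. -/
def leapfrog {d : ℕ} (f : Vec d → ℝ) (η : ℝ) (k : ℕ) (z : Vec d × Vec d) : Vec d × Vec d :=
  (leapfrogStep f η)^[k] z

/-- The HMC proposal distribution at `q₀`: the law of the position `q_K` after `K` leapfrog steps
from `(q₀, p₀)` with standard Gaussian momentum `p₀`. -/
def hmcProposal {d : ℕ} (f : Vec d → ℝ) (η : ℝ) (K : ℕ) (q₀ : Vec d) : Measure (Vec d) :=
  (ProbabilityTheory.stdGaussian (Vec d)).map fun p₀ => (leapfrog f η K (q₀, p₀)).1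

/-- Total variation distance `sup_A |P(A) - Q(A)|` over measurable sets `A`
(meant for probability measures). -/
def tvDist {α : Type*} [MeasurableSpace α] (P Q : Measure α) : ℝ :=
  sSup {r | ∃ A : Set α, MeasurableSet A ∧ r = |P.real A - Q.real A|}

end

/-! Write `N` for the standard Gaussian, `τ = Kη`, and `G`, `H` for the maps `p₀ ↦ q_K` started at
the two given positions. Since `τ²L ≤ 1/16`, both maps are within relative error `1/8` of the
dilation by `τ`, hence bijective. Put `Φ = H⁻¹ ∘ G` and `Ψ = Φ⁻¹`. Then `H_* N = G_* (Ψ_* N)`, and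
data processing reduces the claim to comparing `N` with `Ψ_* N`.

With `u = Φ - id`, the density of `Ψ_* N` relative to `N` is `|det Φ'| exp(‖x‖²/2 - ‖Φ x‖²/2)`, so
the relative entropy is `E[⟨x, u⟩ + ‖u‖²/2 - log |det (1 + u')|]`. Stein's identity `E⟨x, u⟩ = E tr
u'` cancels the first-order part of the log-determinant. What remains is at most `a²/2 + 5b²`, where
`a` bounds `‖u‖` and `b` bounds the Frobenius norm of `u'`; the dimension does not appear
(`klDiv_stdGaussian_map_inverse_le`, `abs_trace_sub_log_abs_det_le`).

The bound `b` is where the `{1,2}{3}`-norm enters: it makes the Hessian Lipschitz from the Euclidean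
to the Frobenius norm. One discrete Grönwall estimate, `norm_leapfrog_recursion_le`, controls the
difference of two trajectories, the Jacobian in `p₀`, and the Frobenius difference of two Jacobians.
Total variation follows from a weak form of Pinsker's inequality. -/

noncomputable section

/-! ### Gaussian density and integration by parts. -/

/-- The Lebesgue density of the standard Gaussian measure on `ℝ^d`. -/
def gaussianDensity {d : ℕ} (x : Vec d) : ℝ :=
  (√(2 * Real.pi))⁻¹ ^ d * Real.exp (-‖x‖ ^ 2 / 2)

theorem gaussianDensity_pos {d : ℕ} (x : Vec d) : 0 < gaussianDensity x := by
  unfold gaussianDensity; positivity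

theorem continuous_gaussianDensity {d : ℕ} : Continuous (gaussianDensity (d := d)) := by
  unfold gaussianDensity; fun_prop

theorem prod_gaussianPDFReal {d : ℕ} (x : Vec d) :
    ∏ i, ProbabilityTheory.gaussianPDFReal 0 1 (x i) = gaussianDensity x := by
  simp only [ProbabilityTheory.gaussianPDFReal, gaussianDensity, Finset.prod_mul_distrib,
    ← Real.exp_sum, EuclideanSpace.norm_sq_eq]
  simp only [← Finset.sum_neg_distrib, Finset.sum_div]
  simp

theorem pi_gaussianReal_eq_withDensity (d : ℕ) :
    Measure.pi (fun _ : Fin d => ProbabilityTheory.gaussianReal 0 1) =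
      (volume : Measure (Fin d → ℝ)).withDensity
        fun x => ENNReal.ofReal (∏ i, ProbabilityTheory.gaussianPDFReal 0 1 (x i)) := by
  refine Measure.pi_eq fun s hs => ?_
  rw [withDensity_apply _ (MeasurableSet.univ_pi hs), volume_pi, Measure.restrict_pi_pi,
    ← ofReal_integral_eq_lintegral_ofReal]
  · rw [integral_fintype_prod_eq_prod, ENNReal.ofReal_prod_of_nonneg]
    · refine Finset.prod_congr rfl fun i _ => ?_
      rw [ProbabilityTheory.gaussianReal_apply_eq_integral 0 one_ne_zero]
    · intro i _
      exact integral_nonneg fun x => ProbabilityTheory.gaussianPDFReal_nonneg 0 1 x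
  · exact Integrable.fintype_prod
      fun i => (ProbabilityTheory.integrable_gaussianPDFReal 0 1).restrict
  · exact Filter.Eventually.of_forall fun x =>
      Finset.prod_nonneg fun i _ => ProbabilityTheory.gaussianPDFReal_nonneg 0 1 _

theorem stdGaussian_eq_withDensity (d : ℕ) :
    ProbabilityTheory.stdGaussian (Vec d) =
      volume.withDensity fun x => ENNReal.ofReal (gaussianDensity x) := by
  ext A hA
  rw [← ProbabilityTheory.map_pi_eq_stdGaussian, Measure.map_apply (by fun_prop) hA,
    pi_gaussianReal_eq_withDensity, withDensity_apply _ hA,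
    withDensity_apply _ ((WithLp.measurable_toLp 2 _) hA),
    ← (PiLp.volume_preserving_toLp (Fin d)).setLIntegral_comp_preimage hA
      (by exact (continuous_gaussianDensity.measurable).ennreal_ofReal)]
  refine lintegral_congr fun x => ?_
  rw [← prod_gaussianPDFReal]

theorem integrable_stdGaussian_iff {d : ℕ} (g : Vec d → ℝ) :
    Integrable g (ProbabilityTheory.stdGaussian (Vec d)) ↔
      Integrable fun x => gaussianDensity x * g x := by
  rw [stdGaussian_eq_withDensity, integrable_withDensity_iff_integrable_smul₀'
    (continuous_gaussianDensity.measurable.ennreal_ofReal.aemeasurable)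
    (by simp)]
  simp [ENNReal.toReal_ofReal (gaussianDensity_pos _).le]

theorem integral_stdGaussian {d : ℕ} (g : Vec d → ℝ) :
    ∫ x, g x ∂(ProbabilityTheory.stdGaussian (Vec d)) = ∫ x, gaussianDensity x * g x := by
  rw [stdGaussian_eq_withDensity, integral_withDensity_eq_integral_toReal_smul
    (continuous_gaussianDensity.measurable.ennreal_ofReal)
    (by simp)]
  simp [ENNReal.toReal_ofReal (gaussianDensity_pos _).le]

theorem hasFDerivAt_gaussianDensity {d : ℕ} (x : Vec d) :
    HasFDerivAt gaussianDensity (-gaussianDensity x • innerSL ℝ x) x := by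
  have h := (((hasStrictFDerivAt_norm_sq x).hasFDerivAt.neg.mul_const (1 / 2 : ℝ)).exp).const_mul
    ((√(2 * Real.pi))⁻¹ ^ d)
  refine (h.congr_fderiv ?_).congr_of_eventuallyEq (Filter.Eventually.of_forall fun y => ?_)
  · ext v
    simp only [gaussianDensity, smul_apply, neg_apply,
      smul_eq_mul, Pi.neg_apply]
    simp
    ring_nf
  · simp [gaussianDensity]; ring_nf; simp

theorem integrable_norm_stdGaussian (d : ℕ) :
    Integrable (fun x : Vec d => ‖x‖) (ProbabilityTheory.stdGaussian (Vec d)) :=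
  (ProbabilityTheory.IsGaussian.integrable_fun_id
    (μ := ProbabilityTheory.stdGaussian (Vec d))).norm

/-- Gaussian integration by parts for a bounded function with bounded derivative. -/
theorem integral_coord_mul_stdGaussian {d : ℕ} {g : Vec d → ℝ} (hg : Differentiable ℝ g) {a b : ℝ}
    (ha : ∀ x, |g x| ≤ a) (i : Fin d) (hb : ∀ x, |fderiv ℝ g x (EuclideanSpace.single i 1)| ≤ b) :
    ∫ x, x i * g x ∂(ProbabilityTheory.stdGaussian (Vec d)) =
      ∫ x, fderiv ℝ g x (EuclideanSpace.single i 1) ∂(ProbabilityTheory.stdGaussian (Vec d)) := by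
  have hρ : ∀ x : Vec d, fderiv ℝ gaussianDensity x (EuclideanSpace.single i 1) =
      -(gaussianDensity x * x i) := fun x => by
    rw [(hasFDerivAt_gaussianDensity x).fderiv]
    simp [EuclideanSpace.inner_single_right]
  have h1 : Integrable (fun x : Vec d => x i * g x) (ProbabilityTheory.stdGaussian (Vec d)) := by
    refine Integrable.mono' ((integrable_norm_stdGaussian d).mul_const a)
      (by have := hg.continuous; fun_prop) (Filter.Eventually.of_forall fun x => ?_)
    rw [norm_mul]
    exact mul_le_mul (PiLp.norm_apply_le x i) (ha x) (norm_nonneg _) (norm_nonneg _)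
  have h2 : Integrable (fun x : Vec d => fderiv ℝ g x (EuclideanSpace.single i 1))
      (ProbabilityTheory.stdGaussian (Vec d)) :=
    Integrable.mono' (integrable_const b) (measurable_fderiv_apply_const ℝ g _).aestronglyMeasurable
      (Filter.Eventually.of_forall hb)
  have h3 : Integrable g (ProbabilityTheory.stdGaussian (Vec d)) :=
    Integrable.mono' (integrable_const a) hg.continuous.aestronglyMeasurable
      (Filter.Eventually.of_forall ha)
  rw [integral_stdGaussian, integral_stdGaussian,
    integral_mul_fderiv_eq_neg_fderiv_mul_of_integrable (𝕜 := ℝ)]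
  · simp only [hρ, ← integral_neg]
    refine integral_congr_ae (Filter.Eventually.of_forall fun x => ?_)
    simp only; ring
  · simp only [hρ]
    refine ((integrable_stdGaussian_iff _).1 h1).neg.congr
      (Filter.Eventually.of_forall fun x => ?_)
    simp only [Pi.neg_apply]; ring
  · exact (integrable_stdGaussian_iff _).1 h2
  · exact (integrable_stdGaussian_iff _).1 h3
  · exact fun x _ => (hasFDerivAt_gaussianDensity x).differentiableAt
  · exact fun x _ => hg x


/-! ### Frobenius norm and log-determinant. -/

/-- The tuple of entries of a linear endomorphism of `ℝ^d`; its norm is the Frobenius norm. -/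
def hsEntries {d : ℕ} : (Vec d →L[ℝ] Vec d) →ₗ[ℝ] EuclideanSpace ℝ (Fin d × Fin d) where
  toFun A := WithLp.toLp 2 fun ij => A (EuclideanSpace.single ij.1 1) ij.2
  map_add' _ _ := rfl
  map_smul' _ _ := rfl

theorem norm_sq_hsEntries {d : ℕ} (A : Vec d →L[ℝ] Vec d) :
    ‖hsEntries A‖ ^ 2 = ∑ i, ‖A (EuclideanSpace.single i 1)‖ ^ 2 := by
  simp_rw [EuclideanSpace.norm_sq_eq, Fintype.sum_prod_type]; rfl

/-- Both sides equal `∑ ⟨A bᵢ, cⱼ⟩²`. As `b` and `c` are independent, this gives basis independence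
of the Frobenius norm. -/
theorem sum_norm_sq_apply_eq_adjoint {d : ℕ} (A : Vec d →L[ℝ] Vec d)
    (b c : OrthonormalBasis (Fin d) ℝ (Vec d)) :
    ∑ i, ‖A (b i)‖ ^ 2 = ∑ j, ‖A.adjoint (c j)‖ ^ 2 := by
  simp_rw [← c.sum_sq_inner_right (A _), ← b.sum_sq_inner_left (A.adjoint _),
    ContinuousLinearMap.adjoint_inner_left]
  exact Finset.sum_comm

theorem sum_norm_sq_apply_orthonormalBasis {d : ℕ} (A : Vec d →L[ℝ] Vec d)
    (b : OrthonormalBasis (Fin d) ℝ (Vec d)) : ∑ i, ‖A (b i)‖ ^ 2 = ‖hsEntries A‖ ^ 2 := by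
  rw [norm_sq_hsEntries, sum_norm_sq_apply_eq_adjoint A b b,
    ← sum_norm_sq_apply_eq_adjoint A (EuclideanSpace.basisFun (Fin d) ℝ) b]
  simp

theorem norm_hsEntries_adjoint {d : ℕ} (A : Vec d →L[ℝ] Vec d) :
    ‖hsEntries A.adjoint‖ = ‖hsEntries A‖ := by
  rw [← sq_eq_sq₀ (norm_nonneg _) (norm_nonneg _),
    ← sum_norm_sq_apply_orthonormalBasis _ (EuclideanSpace.basisFun (Fin d) ℝ),
    ← sum_norm_sq_apply_orthonormalBasis _ (EuclideanSpace.basisFun (Fin d) ℝ),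
    ← sum_norm_sq_apply_eq_adjoint]

theorem norm_hsEntries_comp_le {d : ℕ} (B A : Vec d →L[ℝ] Vec d) :
    ‖hsEntries (B ∘L A)‖ ≤ ‖B‖ * ‖hsEntries A‖ := by
  refine le_of_sq_le_sq ?_ (by positivity)
  rw [mul_pow, norm_sq_hsEntries, norm_sq_hsEntries, Finset.mul_sum]
  refine Finset.sum_le_sum fun i _ => ?_
  rw [← mul_pow]
  gcongr
  exact B.le_opNorm _

theorem norm_hsEntries_comp_le' {d : ℕ} (A B : Vec d →L[ℝ] Vec d) :
    ‖hsEntries (A ∘L B)‖ ≤ ‖hsEntries A‖ * ‖B‖ := by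
  rw [← norm_hsEntries_adjoint, ContinuousLinearMap.adjoint_comp, mul_comm, ← norm_hsEntries_adjoint A,
    ← LinearIsometryEquiv.norm_map ContinuousLinearMap.adjoint B]
  exact norm_hsEntries_comp_le _ _

/-- For a small perturbation `A`, the logarithm of `|det (1 + A)|` is the trace of `A` up to an
error that is quadratic in the Frobenius norm. -/
theorem abs_trace_sub_log_abs_det_le {d : ℕ} {A : Vec d →L[ℝ] Vec d} (hA : ‖A‖ ≤ 2 / 7) :
    0 < |(1 + A).det| ∧
    |∑ i, A (EuclideanSpace.single i 1) i - Real.log (|(1 + A).det|)| ≤ 5 * ‖hsEntries A‖ ^ 2 := by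
  have hn : Module.finrank ℝ (Vec d) = d := finrank_euclideanSpace_fin
  -- `A` need not be symmetric, so the determinant is read off the eigenvalues of `(1 + A)* (1 +
  -- A)`, and the trace of `A` is taken in the same eigenbasis.
  set T : Vec d →L[ℝ] Vec d := (1 + A).adjoint ∘L (1 + A) with hT
  have hsym : (T : Vec d →ₗ[ℝ] Vec d).IsSymmetric := fun x y => by
    rw [ContinuousLinearMap.coe_coe, hT, ContinuousLinearMap.comp_apply,
      ContinuousLinearMap.adjoint_inner_left, ContinuousLinearMap.comp_apply,
      ContinuousLinearMap.adjoint_inner_right]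
  set b := hsym.eigenvectorBasis hn with hb
  set μ := hsym.eigenvalues hn with hμ
  have hdet : |(1 + A).det| ^ 2 = ∏ i, μ i := by
    have h1 := ContinuousLinearMap.normDet_sq (1 + A)
    have h2 := hsym.det_eq_prod_eigenvalues hn
    rw [LinearMap.normDet_eq_abs_det] at h1
    exact h1.trans h2
  have hμA : ∀ i, μ i = 1 + (2 * inner ℝ (b i) (A (b i)) + ‖A (b i)‖ ^ 2) := fun i => by
    have h1 : inner ℝ (b i) (T (b i)) = μ i := by
      have := hsym.apply_eigenvectorBasis hn i
      rw [ContinuousLinearMap.coe_coe] at this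
      rw [this, inner_smul_right, real_inner_self_eq_norm_sq, b.norm_eq_one]
      simp [hμ]
    rw [← h1, hT, ContinuousLinearMap.comp_apply, ContinuousLinearMap.adjoint_inner_right,
      real_inner_self_eq_norm_sq]
    simp only [add_apply, one_apply_eq_self]
    rw [norm_add_sq_real, b.norm_eq_one]
    ring
  have hAb : ∀ i, ‖A (b i)‖ ≤ 2 / 7 := fun i => by
    have := A.le_opNorm (b i)
    rw [b.norm_eq_one, mul_one] at this
    exact this.trans hA
  have hin : ∀ i, |inner ℝ (b i) (A (b i))| ≤ ‖A (b i)‖ := fun i => by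
    have := abs_real_inner_le_norm (b i) (A (b i))
    rwa [b.norm_eq_one, one_mul] at this
  -- In fact `μ i ≥ (1 - 2/7)² = 25/49`; the value `24/49` leaves room for strictness.
  have hμpos : ∀ i, 24 / 49 < μ i := fun i => by
    have h1 := abs_le.1 (hin i)
    have h2 := hAb i
    have h0 := norm_nonneg (A (b i))
    rw [hμA]
    nlinarith
  have htr : ∑ i, A (EuclideanSpace.single i 1) i = ∑ i, inner ℝ (b i) (A (b i)) := by
    have h1 := LinearMap.trace_eq_sum_inner (A : Vec d →ₗ[ℝ] Vec d) b
    have h2 := LinearMap.trace_eq_sum_inner (A : Vec d →ₗ[ℝ] Vec d)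
      (EuclideanSpace.basisFun (Fin d) ℝ)
    rw [h1] at h2
    simpa [EuclideanSpace.inner_single_left] using h2.symm
  have hlog : 2 * Real.log |(1 + A).det| = ∑ i, Real.log (μ i) := by
    have h1 := Real.log_pow (|(1 + A).det|) 2
    rw [hdet, Real.log_prod fun i _ => ((by norm_num : (0 : ℝ) < 24 / 49).trans (hμpos i)).ne'] at h1
    exact_mod_cast h1.symm
  refine ⟨abs_pos.2 fun h => ?_, ?_⟩
  · rw [h] at hdet
    have : 0 < ∏ i, μ i :=
      Finset.prod_pos fun i _ => (by norm_num : (0 : ℝ) < 24 / 49).trans (hμpos i)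
    simp [← hdet] at this
  -- From `μ - 1 - (49/24)(μ - 1)² ≤ log μ ≤ μ - 1` and `|μ - 1| ≤ (16/7) t`: the error lies between
  -- `-t²` and `(256/24 - 1) t²`, below `10 t²`.
  · have key : ∀ i, |2 * inner ℝ (b i) (A (b i)) - Real.log (μ i)| ≤ 10 * ‖A (b i)‖ ^ 2 := by
      intro i
      have hp := (by norm_num : (0 : ℝ) < 24 / 49).trans (hμpos i)
      have h1 := Real.log_le_sub_one_of_pos hp
      have h2 := Real.one_sub_inv_le_log_of_pos hp
      have h3 := abs_le.1 (hin i)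
      have h0 := norm_nonneg (A (b i))
      have h4 := hAb i
      set t := ‖A (b i)‖
      set s := inner ℝ (b i) (A (b i))
      have h5 := hμA i
      have h6 : |μ i - 1| ≤ 16 / 7 * t := by
        rw [h5, abs_le]; constructor <;> nlinarith
      have h7 : (μ i - 1) ^ 2 ≤ (16 / 7 * t) ^ 2 := sq_le_sq' (abs_le.1 h6).1 (abs_le.1 h6).2
      have h8 : μ i - 1 - 49 / 24 * (μ i - 1) ^ 2 ≤ 1 - (μ i)⁻¹ := by
        have : 1 - (μ i)⁻¹ - (μ i - 1 - 49 / 24 * (μ i - 1) ^ 2) =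
            (μ i - 1) ^ 2 * (49 / 24 - (μ i)⁻¹) := by field_simp; ring
        have h9 : (μ i)⁻¹ ≤ 49 / 24 := by
          rw [inv_le_comm₀ hp (by norm_num)]; norm_num; exact (hμpos i).le
        nlinarith [mul_nonneg (sq_nonneg (μ i - 1)) (sub_nonneg.2 h9)]
      rw [abs_le]
      constructor <;> nlinarith [sq_nonneg t]
    have h1 : ∑ i, A (EuclideanSpace.single i 1) i - Real.log |(1 + A).det| =
        (∑ i, (2 * inner ℝ (b i) (A (b i)) - Real.log (μ i))) / 2 := by
      rw [htr, Finset.sum_sub_distrib, ← hlog, ← Finset.mul_sum]; ring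
    rw [h1, abs_div, abs_two, ← sum_norm_sq_apply_orthonormalBasis A b]
    have := (Finset.abs_sum_le_sum_abs _ _).trans
      (Finset.sum_le_sum fun i (_ : i ∈ Finset.univ) => key i)
    rw [← Finset.mul_sum] at this
    linarith


/-! ### Relative entropy and total variation. -/

/-- Change of variables for the standard Gaussian measure. -/
theorem stdGaussian_map_inverse_eq_withDensity {d : ℕ} {Φ Ψ : Vec d → Vec d}
    {Φ' : Vec d → Vec d →L[ℝ] Vec d} (hΨ : Measurable Ψ) (hl : Function.LeftInverse Ψ Φ)
    (hr : Function.RightInverse Ψ Φ) (hΦ : ∀ x, HasFDerivAt Φ (Φ' x) x) :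
    (ProbabilityTheory.stdGaussian (Vec d)).map Ψ =
      (ProbabilityTheory.stdGaussian (Vec d)).withDensity fun x => ENNReal.ofReal
        (|(Φ' x).det| * Real.exp (‖x‖ ^ 2 / 2 - ‖Φ x‖ ^ 2 / 2)) := by
  ext A hA
  -- Preimages under `Ψ` are images under `Φ`, so the area formula is applied to `Φ` and `Ψ` need
  -- only be measurable.
  have himg : Ψ ⁻¹' A = Φ '' A := (congrFun (Set.image_eq_preimage_of_inverse hl hr) A).symm
  have hΦ'eq : Φ' = fderiv ℝ Φ := funext fun x => ((hΦ x).fderiv).symm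
  have hΦc : Continuous Φ :=
    continuous_iff_continuousAt.2 fun x => (hΦ x).continuousAt
  have hm : Measurable fun x => ENNReal.ofReal
      (|(Φ' x).det| * Real.exp (‖x‖ ^ 2 / 2 - ‖Φ x‖ ^ 2 / 2)) := by
    have h1 : Measurable fun x => (Φ' x).det :=
      ContinuousLinearMap.continuous_det.measurable.comp (hΦ'eq ▸ measurable_fderiv ℝ Φ)
    have h2 := hΦc.measurable
    fun_prop
  rw [Measure.map_apply hΨ hA, himg, stdGaussian_eq_withDensity,
    withDensity_apply _ (himg ▸ hΨ hA),
    lintegral_image_eq_lintegral_abs_det_fderiv_mul volume hA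
      (fun x _ => (hΦ x).hasFDerivWithinAt) hl.injective.injOn,
    ← withDensity_mul _ (continuous_gaussianDensity.measurable.ennreal_ofReal) hm,
    withDensity_apply _ hA]
  refine lintegral_congr fun x => ?_
  rw [Pi.mul_apply, ← ENNReal.ofReal_mul (abs_nonneg _),
    ← ENNReal.ofReal_mul (gaussianDensity_pos x).le]
  congr 1
  have : gaussianDensity (Φ x) =
      gaussianDensity x * Real.exp (‖x‖ ^ 2 / 2 - ‖Φ x‖ ^ 2 / 2) := by
    rw [gaussianDensity, gaussianDensity, mul_assoc, ← Real.exp_add]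
    ring_nf
  rw [this]; ring

theorem klDiv_withDensity_right {α : Type*} [MeasurableSpace α] {μ : Measure α}
    [IsProbabilityMeasure μ] {r : α → ℝ} (hr : Measurable r) (hpos : ∀ x, 0 < r x)
    (hint : Integrable (fun x => Real.log (r x)) μ)
    [IsProbabilityMeasure (μ.withDensity fun x => ENNReal.ofReal (r x))] :
    InformationTheory.klDiv μ (μ.withDensity fun x => ENNReal.ofReal (r x)) =
      ENNReal.ofReal (∫ x, -Real.log (r x) ∂μ) := by
  have hac : μ ≪ μ.withDensity fun x => ENNReal.ofReal (r x) :=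
    withDensity_absolutelyContinuous' hr.ennreal_ofReal.aemeasurable
      (Filter.Eventually.of_forall fun x => by simpa using hpos x)
  have hllr : llr μ (μ.withDensity fun x => ENNReal.ofReal (r x)) =ᵐ[μ]
      fun x => -Real.log (r x) := by
    have h1 := Measure.rnDeriv_withDensity_right μ μ (f := fun x => ENNReal.ofReal (r x))
      hr.ennreal_ofReal.aemeasurable
      (Filter.Eventually.of_forall fun x => by simpa using hpos x) (by simp)
    have h2 := Measure.rnDeriv_self μ
    filter_upwards [h1, h2] with x h1 h2
    rw [llr, h1, h2]
    simp [ENNReal.toReal_ofReal (hpos x).le, Real.log_inv]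
  rw [InformationTheory.klDiv_of_ac_of_integrable hac (hint.neg.congr hllr.symm),
    integral_congr_ae hllr]
  simp

/-- A map close to the identity moves the standard Gaussian little in relative entropy. -/
theorem klDiv_stdGaussian_map_inverse_le {d : ℕ} {Φ Ψ : Vec d → Vec d}
    {Φ' : Vec d → Vec d →L[ℝ] Vec d} (hΨ : Measurable Ψ) (hl : Function.LeftInverse Ψ Φ)
    (hr : Function.RightInverse Ψ Φ) (hΦ : ∀ x, HasFDerivAt Φ (Φ' x) x) {a b : ℝ}
    (ha : ∀ x, ‖Φ x - x‖ ≤ a) (hop : ∀ x, ‖Φ' x - 1‖ ≤ 2 / 7)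
    (hb : ∀ x, ‖hsEntries (Φ' x - 1)‖ ≤ b) :
    InformationTheory.klDiv (ProbabilityTheory.stdGaussian (Vec d))
        ((ProbabilityTheory.stdGaussian (Vec d)).map Ψ) ≤
      ENNReal.ofReal (a ^ 2 / 2 + 5 * b ^ 2) := by
  set N := ProbabilityTheory.stdGaussian (Vec d)
  have hΦ'eq : Φ' = fderiv ℝ Φ := funext fun x => ((hΦ x).fderiv).symm
  have hΦc : Continuous Φ := continuous_iff_continuousAt.2 fun x => (hΦ x).continuousAt
  have hΦ'm : Measurable Φ' := hΦ'eq ▸ measurable_fderiv ℝ Φ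
  have hdetm : Measurable fun x => (Φ' x).det :=
    ContinuousLinearMap.continuous_det.measurable.comp hΦ'm
  have hdet : ∀ x, 0 < |(Φ' x).det| := fun x => by
    simpa using (abs_trace_sub_log_abs_det_le (hop x)).1
  have htr : ∀ x, |∑ i, (Φ' x - 1) (EuclideanSpace.single i 1) i -
      Real.log (|(Φ' x).det|)| ≤ 5 * b ^ 2 := fun x => by
    have h1 := (abs_trace_sub_log_abs_det_le (hop x)).2
    rw [add_sub_cancel] at h1
    refine h1.trans ?_
    gcongr
    exact hb x
  set u : Vec d → Vec d := fun x => Φ x - x with hu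
  have hu' : ∀ x, HasFDerivAt u (Φ' x - 1) x := fun x => (hΦ x).sub (hasFDerivAt_id x)
  have hui : ∀ i x, HasFDerivAt (fun y => u y i)
      ((EuclideanSpace.proj i : Vec d →L[ℝ] ℝ) ∘L (Φ' x - 1)) x := fun i x =>
    (EuclideanSpace.proj i : Vec d →L[ℝ] ℝ).hasFDerivAt.comp x (hu' x)
  have hent : ∀ i x, |(Φ' x - 1) (EuclideanSpace.single i 1) i| ≤ 2 / 7 := fun i x => by
    have h1 := (Φ' x - 1).le_opNorm (EuclideanSpace.single i 1)
    rw [PiLp.norm_single, norm_one, mul_one] at h1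
    exact (PiLp.norm_apply_le _ i).trans (h1.trans (hop x))
  have hua : ∀ i x, |u x i| ≤ a := fun i x => (PiLp.norm_apply_le _ i).trans (ha x)
  have huc : Continuous u := hΦc.sub continuous_id
  have hstein : ∀ i, ∫ x, x i * u x i ∂N =
      ∫ x, (Φ' x - 1) (EuclideanSpace.single i 1) i ∂N := fun i => by
    rw [integral_coord_mul_stdGaussian (g := fun y => u y i)
      (fun x => (hui i x).differentiableAt) (hua i) i (b := 2 / 7)]
    · simp only [(hui i _).fderiv]; rfl
    · intro x; rw [(hui i x).fderiv]; exact hent i x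
  have hI1 : ∀ i, Integrable (fun x : Vec d => x i * u x i) N := fun i => by
    refine Integrable.mono' ((integrable_norm_stdGaussian d).mul_const a)
      (by fun_prop) (Filter.Eventually.of_forall fun x => ?_)
    rw [norm_mul]
    exact mul_le_mul (PiLp.norm_apply_le x i) (hua i x) (norm_nonneg _) (norm_nonneg _)
  have hI2 : ∀ i, Integrable (fun x : Vec d => (Φ' x - 1) (EuclideanSpace.single i 1) i) N := by
    intro i
    refine Integrable.mono' (integrable_const (2 / 7)) ?_ (Filter.Eventually.of_forall (hent i))
    have h1 : Measurable fun x => Φ' x (EuclideanSpace.single i 1) :=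
      (ContinuousLinearMap.apply ℝ (Vec d) (EuclideanSpace.single i 1)).continuous.measurable.comp
        hΦ'm
    have h2 : Measurable fun x => (Φ' x - 1) (EuclideanSpace.single i 1) := h1.sub_const _
    fun_prop
  have hI3 : Integrable (fun x => ‖u x‖ ^ 2 / 2) N := by
    refine Integrable.mono' (integrable_const (a ^ 2 / 2)) (by fun_prop)
      (Filter.Eventually.of_forall fun x => ?_)
    rw [Real.norm_of_nonneg (by positivity)]
    gcongr
    exact ha x
  have hI4 : Integrable (fun x => ∑ i, (Φ' x - 1) (EuclideanSpace.single i 1) i -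
      Real.log (|(Φ' x).det|)) N := by
    refine Integrable.mono' (integrable_const (5 * b ^ 2)) ?_ (Filter.Eventually.of_forall htr)
    refine (integrable_finsetSum _ fun i _ => hI2 i).aestronglyMeasurable.sub ?_
    exact Measurable.aestronglyMeasurable (by fun_prop)
  -- The first bracket has mean zero by `hstein`; the second is bounded pointwise by `a²/2 + 5b²`.
  have hlog : (fun x => -Real.log (|(Φ' x).det| * Real.exp (‖x‖ ^ 2 / 2 - ‖Φ x‖ ^ 2 / 2))) =
      fun x => (∑ i, x i * u x i - ∑ i, (Φ' x - 1) (EuclideanSpace.single i 1) i) +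
        (‖u x‖ ^ 2 / 2 + (∑ i, (Φ' x - 1) (EuclideanSpace.single i 1) i -
          Real.log (|(Φ' x).det|))) := by
    funext x
    have h1 : Φ x = x + u x := by simp [hu]
    have h2 : inner ℝ x (u x) = ∑ i, x i * u x i := by
      simp [PiLp.inner_apply, mul_comm]
    rw [Real.log_mul (hdet x).ne' (Real.exp_ne_zero _), Real.log_exp, h1, norm_add_sq_real, h2]
    ring
  have hI5 : Integrable (fun x => ∑ i, x i * u x i -
      ∑ i, (Φ' x - 1) (EuclideanSpace.single i 1) i) N :=
    (integrable_finsetSum _ fun i _ => hI1 i).sub (integrable_finsetSum _ fun i _ => hI2 i)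
  have hI7 : Integrable (fun x => ‖u x‖ ^ 2 / 2 +
      (∑ i, (Φ' x - 1) (EuclideanSpace.single i 1) i - Real.log (|(Φ' x).det|))) N :=
    hI3.add hI4
  have hI6 : Integrable (fun x => -Real.log (|(Φ' x).det| *
      Real.exp (‖x‖ ^ 2 / 2 - ‖Φ x‖ ^ 2 / 2))) N := by
    rw [hlog]; exact hI5.add hI7
  have hmap := stdGaussian_map_inverse_eq_withDensity hΨ hl hr hΦ
  have : IsProbabilityMeasure (N.map Ψ) := Measure.isProbabilityMeasure_map hΨ.aemeasurable
  rw [hmap] at this ⊢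
  rw [klDiv_withDensity_right (by have := hΦc.measurable; fun_prop)
    (fun x => mul_pos (hdet x) (Real.exp_pos _)) (by simpa using hI6.neg)]
  refine ENNReal.ofReal_le_ofReal ?_
  rw [hlog, integral_add hI5 hI7, integral_sub (integrable_finsetSum _ fun i _ => hI1 i)
    (integrable_finsetSum _ fun i _ => hI2 i), integral_finsetSum _ fun i _ => hI1 i,
    integral_finsetSum _ fun i _ => hI2 i, Finset.sum_congr rfl fun i _ => hstein i, sub_self,
    zero_add]
  have h1 : ∫ x, (‖u x‖ ^ 2 / 2 + (∑ i, (Φ' x - 1) (EuclideanSpace.single i 1) i -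
          Real.log (|(Φ' x).det|))) ∂N ≤ ∫ _, (a ^ 2 / 2 + 5 * b ^ 2) ∂N := by
    refine integral_mono hI7 (integrable_const _) fun x => ?_
    have h2 := (abs_le.1 (htr x)).2
    have h3 : ‖u x‖ ^ 2 ≤ a ^ 2 := pow_le_pow_left₀ (norm_nonneg _) (ha x) 2
    simp only
    linarith
  simpa using h1

/-- Pinsker with a lossy constant: the Fenchel inequality `klFun x ≥ t x - (eᵗ - 1)`, integrated
over the single set `A`, with `eᵗ - 1 ≤ t + t²`. The choice `t = δ/2` yields `δ²/4 ≤ c`. -/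
theorem tvDist_le_sqrt_of_klDiv_le {α : Type*} [MeasurableSpace α] {P Q : Measure α}
    [IsProbabilityMeasure P] [IsProbabilityMeasure Q] {c : ℝ} (hc : 0 ≤ c)
    (h : InformationTheory.klDiv P Q ≤ ENNReal.ofReal c) : tvDist P Q ≤ Real.sqrt (4 * c) := by
  have hne : InformationTheory.klDiv P Q ≠ ⊤ := ne_top_of_le_ne_top ENNReal.ofReal_ne_top h
  obtain ⟨hac, hint⟩ := InformationTheory.klDiv_ne_top_iff.1 hne
  have hkl : ∫ x, InformationTheory.klFun (P.rnDeriv Q x).toReal ∂Q ≤ c := by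
    rw [← InformationTheory.toReal_klDiv_eq_integral_klFun hac]
    exact ENNReal.toReal_le_of_le_ofReal hc h
  have hfen : ∀ t x : ℝ, 0 ≤ x → t * x - (Real.exp t - 1) ≤ InformationTheory.klFun x := by
    intro t x hx
    rcases hx.eq_or_lt with rfl | hx
    · rw [InformationTheory.klFun_zero]
      linarith [Real.exp_pos t]
    · have h1 := Real.add_one_le_exp (t - Real.log x)
      rw [Real.exp_sub, Real.exp_log hx, le_div_iff₀ hx] at h1
      rw [InformationTheory.klFun_apply]
      linarith
  refine csSup_le ⟨_, ∅, MeasurableSet.empty, rfl⟩ ?_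
  rintro _ ⟨A, hA, rfl⟩
  refine Real.le_sqrt_of_sq_le ?_
  rw [sq_abs]
  set δ := P.real A - Q.real A with hδ
  have hδ1 : |δ / 2| ≤ 1 := by
    have h1 := measureReal_le_one (μ := P) (s := A)
    have h2 := measureReal_le_one (μ := Q) (s := A)
    have h3 := measureReal_nonneg (μ := P) (s := A)
    have h4 := measureReal_nonneg (μ := Q) (s := A)
    rw [abs_le]; constructor <;> linarith
  have hexp : Real.exp (δ / 2) - 1 ≤ δ / 2 + (δ / 2) ^ 2 := by
    have := (abs_le.1 (Real.abs_exp_sub_one_sub_id_le hδ1)).2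
    linarith
  have hrn : Integrable (fun x => (P.rnDeriv Q x).toReal) Q := Measure.integrable_toReal_rnDeriv
  have hk := (InformationTheory.integrable_klFun_rnDeriv_iff hac).2 hint
  have h1 : ∫ x in A, (δ / 2 * (P.rnDeriv Q x).toReal - (Real.exp (δ / 2) - 1)) ∂Q ≤
      ∫ x in A, InformationTheory.klFun (P.rnDeriv Q x).toReal ∂Q :=
    integral_mono ((hrn.const_mul _).sub (integrable_const _)).restrict hk.restrict
      fun x => hfen _ _ ENNReal.toReal_nonneg
  have h2 : ∫ x in A, InformationTheory.klFun (P.rnDeriv Q x).toReal ∂Q ≤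
      ∫ x, InformationTheory.klFun (P.rnDeriv Q x).toReal ∂Q :=
    setIntegral_le_integral hk (Filter.Eventually.of_forall fun x =>
      InformationTheory.klFun_nonneg ENNReal.toReal_nonneg)
  rw [integral_sub (hrn.const_mul _).restrict (integrable_const _), integral_const_mul,
    Measure.setIntegral_toReal_rnDeriv hac, setIntegral_const, smul_eq_mul] at h1
  have h3 := measureReal_nonneg (μ := Q) (s := A)
  have h4 := measureReal_le_one (μ := Q) (s := A)
  have h5 : Q.real A * (Real.exp (δ / 2) - 1) ≤ Q.real A * (δ / 2 + (δ / 2) ^ 2) := by gcongr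
  nlinarith [sq_nonneg (δ / 2)]


/-! ### Hessian and third derivative of the potential. -/

/-- The Riesz isomorphism as a real-linear map. -/
def riesz {d : ℕ} : (Vec d →L[ℝ] ℝ) →L[ℝ] Vec d :=
  LinearMap.toContinuousLinearMap
    { toFun := fun φ => (InnerProductSpace.toDual ℝ (Vec d)).symm φ
      map_add' := fun _ _ => map_add _ _ _
      map_smul' := fun _ _ => by simp }

theorem inner_riesz {d : ℕ} (φ : (Vec d →L[ℝ] ℝ)) (v : Vec d) : inner ℝ (riesz φ) v = φ v :=
  InnerProductSpace.toDual_symm_apply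

theorem riesz_apply {d : ℕ} (φ : (Vec d →L[ℝ] ℝ)) (i : Fin d) :
    riesz φ i = φ (EuclideanSpace.single i 1) := by
  rw [← inner_riesz, EuclideanSpace.inner_single_right]; simp

/-- The Hessian as a linear endomorphism. -/
def hessian {d : ℕ} (f : Vec d → ℝ) (x : Vec d) : Vec d →L[ℝ] Vec d :=
  riesz ∘L fderiv ℝ (fderiv ℝ f) x

theorem hasFDerivAt_gradient {d : ℕ} {f : Vec d → ℝ} (hf : Differentiable ℝ (fderiv ℝ f))
    (x : Vec d) : HasFDerivAt (gradient f) (hessian f x) x :=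
  riesz.hasFDerivAt.comp x (hf x).hasFDerivAt

/-- Polarization turns the two-sided bound on the quadratic form into a bound on the symmetric
bilinear form. -/
theorem LSmooth.norm_hessian_le {d : ℕ} {f : Vec d → ℝ} {L : ℝ} (hL : 0 ≤ L) (h : LSmooth L f)
    (x : Vec d) : ‖hessian f x‖ ≤ L := by
  have hsymm := second_derivative_symmetric (𝕜 := ℝ) (fun y => (h.differentiable y).hasFDerivAt)
    (h.differentiable_fderiv x).hasFDerivAt
  set T := fderiv ℝ (fderiv ℝ f) x with hT
  have hpol : ∀ v w, T v w ≤ L / 2 * (‖v‖ ^ 2 + ‖w‖ ^ 2) := fun v w => by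
    have h1 := h.hessian_le x (v + w)
    have h2 := h.neg_le_hessian x (v - w)
    have h3 := parallelogram_law_with_norm ℝ v w
    have h4 := hsymm v w
    rw [← hT] at h1 h2
    simp only [map_add, map_sub, add_apply, sub_apply] at h1 h2
    nlinarith
  refine ContinuousLinearMap.opNorm_le_bound _ hL fun v => ?_
  have hin : ∀ w, inner ℝ (hessian f x v) w = T v w := fun w => inner_riesz _ _
  set y := hessian f x v with hy
  rcases eq_or_ne y 0 with h0 | h0
  · rw [h0, norm_zero]; positivity
  have hv : v ≠ 0 := by rintro rfl; exact h0 (by simp [hy])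
  -- Rescaling `y` to the length of `v` makes the arithmetic-mean bound in `hpol` sharp.
  have h1 := hpol v ((‖v‖ / ‖y‖) • y)
  have hy0 := norm_pos_iff.2 h0
  have hv0 := norm_pos_iff.2 hv
  rw [← hin, inner_smul_right, real_inner_self_eq_norm_sq, norm_smul, norm_div, norm_norm,
    norm_norm, div_mul_cancel₀ _ hy0.ne'] at h1
  have h2 : ‖v‖ / ‖y‖ * ‖y‖ ^ 2 = ‖v‖ * ‖y‖ := by field_simp
  rw [h2] at h1
  have h3 : ‖v‖ * ‖y‖ ≤ ‖v‖ * (L * ‖v‖) := by linarith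
  exact le_of_mul_le_mul_left h3 hv0

theorem LSmooth.norm_gradient_sub_le {d : ℕ} {f : Vec d → ℝ} {L : ℝ} (hL : 0 ≤ L)
    (h : LSmooth L f) (x y : Vec d) : ‖gradient f x - gradient f y‖ ≤ L * ‖x - y‖ :=
  convex_univ.norm_image_sub_le_of_norm_hasFDerivWithin_le
    (fun z _ => (hasFDerivAt_gradient h.differentiable_fderiv z).hasFDerivWithinAt)
    (fun z _ => h.norm_hessian_le hL z) (Set.mem_univ _) (Set.mem_univ _)

theorem hasFDerivAt_hessian_apply {d : ℕ} {f : Vec d → ℝ}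
    (h3 : Differentiable ℝ (fderiv ℝ (fderiv ℝ f))) (x v w : Vec d) :
    HasFDerivAt (fun z => fderiv ℝ (fderiv ℝ f) z v w)
      (((fderiv ℝ (fderiv ℝ (fderiv ℝ f)) x).flip v).flip w) x := by
  refine ((((h3 x).hasFDerivAt.clm_apply (hasFDerivAt_const v x))).clm_apply
    (hasFDerivAt_const w x)).congr_fderiv ?_
  ext; simp

/-- Moves the direction of differentiation from the first slot to the last one, which the
`{1,2}{3}`-norm pairs with `y`. The last two slots commute because the Hessian is symmetric at every
point, the first two by symmetry of the second derivative of `fderiv ℝ f`. -/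
theorem third_derivative_cyclic {d : ℕ} {f : Vec d → ℝ} (h1 : Differentiable ℝ f)
    (h2 : Differentiable ℝ (fderiv ℝ f)) (h3 : Differentiable ℝ (fderiv ℝ (fderiv ℝ f)))
    (x a b c : Vec d) :
    fderiv ℝ (fderiv ℝ (fderiv ℝ f)) x a b c = fderiv ℝ (fderiv ℝ (fderiv ℝ f)) x b c a := by
  have hsw : ∀ a b c, fderiv ℝ (fderiv ℝ (fderiv ℝ f)) x a b c =
      fderiv ℝ (fderiv ℝ (fderiv ℝ f)) x a c b := fun a b c => by
    have heq : (fun z => fderiv ℝ (fderiv ℝ f) z b c) = fun z => fderiv ℝ (fderiv ℝ f) z c b :=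
      funext fun z => second_derivative_symmetric (𝕜 := ℝ) (fun y => (h1 y).hasFDerivAt)
        (h2 z).hasFDerivAt b c
    have := hasFDerivAt_hessian_apply h3 x b c
    rw [heq] at this
    exact congrArg (fun φ : Vec d →L[ℝ] ℝ => φ a) (this.unique (hasFDerivAt_hessian_apply h3 x c b))
  have := second_derivative_symmetric (𝕜 := ℝ) (fun y => (h2 y).hasFDerivAt) (h3 x).hasFDerivAt a b
  rw [this, hsw]

theorem sqrt_sum_sq_contract_le {d : ℕ} {A : Fin d → Fin d → Fin d → ℝ} {M : ℝ}
    (hA : pairSingleNorm A ≤ M) (y : Vec d) {s : ℝ} (hs : 0 ≤ s)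
    (hsq : s ^ 2 = ∑ i, ∑ j, (∑ k, A i j k * y k) ^ 2) : s ≤ M * ‖y‖ := by
  have hM : 0 ≤ M := (le_csSup (pairSingleValues_bddAbove A) ⟨0, 0, by simp, by simp, by simp⟩).trans
    hA
  rcases hs.eq_or_lt with rfl | hs
  · positivity
  have hy : 0 < ‖y‖ := by
    rw [norm_pos_iff]
    rintro rfl
    simp only [PiLp.zero_apply, mul_zero, Finset.sum_const_zero, ne_eq, OfNat.ofNat_ne_zero,
      not_false_eq_true, zero_pow] at hsq
    exact hs.ne' (pow_eq_zero_iff two_ne_zero |>.1 hsq)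
  have hmem : s / ‖y‖ ∈ pairSingleValues A := by
    -- The normalized contraction is the maximizing `X`, by duality of the Frobenius norm.
    refine ⟨fun i j => (∑ k, A i j k * y k) / s, fun k => y k / ‖y‖, ?_, ?_, ?_⟩
    · simp_rw [div_pow, ← Finset.sum_div, ← hsq]
      exact (div_self (by positivity)).le
    · simp_rw [div_pow, ← Finset.sum_div]
      rw [EuclideanSpace.norm_sq_eq]
      simp only [Real.norm_eq_abs, sq_abs]
      exact div_self_le_one _
    · have h1 : ∀ i j, ∑ k, A i j k * ((∑ k, A i j k * y k) / s) * (y k / ‖y‖) =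
          (∑ k, A i j k * y k) ^ 2 / (s * ‖y‖) := fun i j => by
        set z := ∑ k, A i j k * y k with hz
        have h2 : ∀ k, A i j k * (z / s) * (y k / ‖y‖) = A i j k * y k * (z / (s * ‖y‖)) :=
          fun k => by field_simp
        simp_rw [h2, ← Finset.sum_mul, ← hz]
        ring
      simp_rw [h1, ← Finset.sum_div, ← hsq]
      field_simp
  have := (le_csSup (pairSingleValues_bddAbove A) hmem).trans hA
  rwa [div_le_iff₀ hy] at this

theorem StronglyHessianLipschitz.norm_hsEntries_hessian_sub_le {d : ℕ} {f : Vec d → ℝ} {M : ℝ}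
    (h : StronglyHessianLipschitz M f) (x y : Vec d) :
    ‖hsEntries (hessian f x - hessian f y)‖ ≤ M * ‖x - y‖ := by
  have happ : ∀ z (ij : Fin d × Fin d), hsEntries (hessian f z) ij = fderiv ℝ (fderiv ℝ f) z
      (EuclideanSpace.single ij.1 1) (EuclideanSpace.single ij.2 1) := fun z ij =>
    riesz_apply _ _
  have hd : Differentiable ℝ fun z => hsEntries (hessian f z) :=
    differentiable_euclidean.2 fun ij z => by
      simp_rw [happ]
      exact (hasFDerivAt_hessian_apply h.differentiable_fderiv_fderiv z _ _).differentiableAt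
  have hd' : ∀ z v (ij : Fin d × Fin d), fderiv ℝ (fun z => hsEntries (hessian f z)) z v ij =
      fderiv ℝ (fderiv ℝ (fderiv ℝ f)) z v (EuclideanSpace.single ij.1 1)
        (EuclideanSpace.single ij.2 1) := fun z v ij => by
    have h1 := (hasFDerivWithinAt_euclidean (t := Set.univ)).1
      (hd z).hasFDerivAt.hasFDerivWithinAt ij
    rw [hasFDerivWithinAt_univ] at h1
    simp_rw [happ] at h1
    exact congrArg (fun φ : Vec d →L[ℝ] ℝ => φ v)
      (h1.unique (hasFDerivAt_hessian_apply h.differentiable_fderiv_fderiv z _ _))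
  have hM : 0 ≤ M := (le_csSup (pairSingleValues_bddAbove (thirdDerivTensor f x))
    ⟨0, 0, by simp, by simp, by simp⟩).trans (h.norm_le x)
  rw [map_sub]
  refine convex_univ.norm_image_sub_le_of_norm_fderiv_le (fun z _ => hd z)
    (fun z _ => ContinuousLinearMap.opNorm_le_bound _ hM fun v => ?_) (Set.mem_univ _)
    (Set.mem_univ _)
  refine sqrt_sum_sq_contract_le (h.norm_le z) v (norm_nonneg _) ?_
  rw [EuclideanSpace.norm_sq_eq, Fintype.sum_prod_type]
  refine Finset.sum_congr rfl fun i _ => Finset.sum_congr rfl fun j _ => ?_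
  rw [Real.norm_eq_abs, sq_abs, hd', third_derivative_cyclic h.differentiable
    h.differentiable_fderiv h.differentiable_fderiv_fderiv]
  congr 1
  conv_lhs => rw [← (EuclideanSpace.basisFun (Fin d) ℝ).sum_repr v]
  simp [thirdDerivTensor, mul_comm]

/-! ### Leapfrog recursion and its stability. -/

/-- A discrete Grönwall estimate for position-velocity recursions of leapfrog type. -/
theorem norm_leapfrog_recursion_le {W : Type*} [NormedAddCommGroup W] [NormedSpace ℝ W]
    {x v g : ℕ → W} {w : W} {η L B : ℝ} {K : ℕ} (hη : 0 ≤ η) (hL : 0 ≤ L) (hB : 0 ≤ B)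
    (hstep : ((K : ℝ) * η) ^ 2 * L ≤ 1 / 16) (hx : ∀ k, x (k + 1) = x k + η • v k)
    (hv0 : v 0 = w - (η / 2) • g 0) (hv : ∀ k, v (k + 1) = v k - η • g (k + 1))
    (hg : ∀ k ≤ K, ‖g k‖ ≤ L * ‖x k‖ + B) {k : ℕ} (hk : k ≤ K) :
    ‖x k - x 0 - ((k : ℝ) * η) • w‖ ≤
      1 / 8 * (‖x 0‖ + K * η * ‖w‖) + 8 / 7 * ((K : ℝ) * η) ^ 2 * B := by
  set τ := (K : ℝ) * η with hτ
  have hτ0 : 0 ≤ τ := by positivity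
  set R := ‖x 0‖ + τ * ‖w‖ with hR
  have hR0 : 0 ≤ R := by positivity
  set S := 1 / 8 * R + 8 / 7 * τ ^ 2 * B with hS
  have hS0 : 0 ≤ S := by positivity
  set C := L * (R + S) + B with hC
  have hC0 : 0 ≤ C := by positivity
  -- Closes the bootstrap: while positions stay within `R + S`, forces are at most `C`, and forces
  -- at most `C` displace positions by at most `τ² C ≤ S`.
  have hCS : τ ^ 2 * C ≤ S := by
    have h1 : τ ^ 2 * L * (R + S) ≤ 1 / 16 * (R + S) := by gcongr
    have h2 : 0 ≤ τ ^ 2 * B := by positivity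
    nlinarith
  have hkη : ∀ k : ℕ, k ≤ K → (k : ℝ) * η ≤ τ := fun k hk => by
    rw [hτ]; gcongr
  have hgC : ∀ k ≤ K, ‖x k - x 0 - ((k : ℝ) * η) • w‖ ≤ k * η * τ * C → ‖g k‖ ≤ C := by
    intro k hk h
    have h1 : ‖x k‖ ≤ R + S := by
      have h2 : x k = (x k - x 0 - ((k : ℝ) * η) • w) + (x 0 + ((k : ℝ) * η) • w) := by abel
      have h3 : ‖x 0 + ((k : ℝ) * η) • w‖ ≤ R := by
        refine (norm_add_le _ _).trans ?_
        rw [norm_smul, Real.norm_of_nonneg (by positivity)]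
        have := hkη k hk
        rw [hR]; gcongr
      have h4 : k * η * τ * C ≤ τ * τ * C := by
        have := hkη k hk
        gcongr
      rw [h2]
      refine (norm_add_le _ _).trans ?_
      nlinarith
    exact (hg k hk).trans (by rw [hC]; gcongr)
  -- The factor `k + 1` arises because `v k` already contains the kick `g k`; the half kick `g 0` is
  -- counted as a full one.
  have main : ∀ k : ℕ, k ≤ K → ‖x k - x 0 - ((k : ℝ) * η) • w‖ ≤ k * η * τ * C ∧
      ‖v k - w‖ ≤ (k + 1) * η * C := by
    intro k
    induction k with
    | zero =>
      intro _
      have h0 : ‖x 0 - x 0 - (((0 : ℕ) : ℝ) * η) • w‖ ≤ ((0 : ℕ) : ℝ) * η * τ * C := by simp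
      refine ⟨h0, ?_⟩
      have h1 := hgC 0 (Nat.zero_le _) h0
      rw [hv0, sub_sub_cancel_left, norm_neg, norm_smul, Real.norm_of_nonneg (by positivity)]
      have : η / 2 * ‖g 0‖ ≤ η * C := by
        have : η / 2 ≤ η := by linarith
        gcongr
      simpa using this
    | succ k ih =>
      intro hk
      obtain ⟨h1, h2⟩ := ih (by omega)
      have h3 : ‖x (k + 1) - x 0 - (((k + 1 : ℕ) : ℝ) * η) • w‖ ≤ ((k + 1 : ℕ) : ℝ) * η * τ * C := by
        have h4 : x (k + 1) - x 0 - (((k + 1 : ℕ) : ℝ) * η) • w =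
            (x k - x 0 - ((k : ℝ) * η) • w) + η • (v k - w) := by
          rw [hx]; push_cast; module
        have h5 := hkη (k + 1) hk
        rw [h4]
        push_cast at h5 ⊢
        refine (norm_add_le _ _).trans ?_
        rw [norm_smul, Real.norm_of_nonneg hη]
        have h6 : η * ‖v k - w‖ ≤ η * (τ * C) := by
          gcongr
          exact h2.trans (by gcongr)
        linarith
      refine ⟨h3, ?_⟩
      have h4 := hgC (k + 1) hk h3
      have h5 : v (k + 1) - w = (v k - w) - η • g (k + 1) := by rw [hv]; abel
      rw [h5]
      refine (norm_sub_le _ _).trans ?_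
      rw [norm_smul, Real.norm_of_nonneg hη]
      have h6 : η * ‖g (k + 1)‖ ≤ η * C := by gcongr
      push_cast
      linarith
  refine (main k hk).1.trans (le_trans ?_ hCS)
  have := hkη k hk
  rw [sq]
  gcongr


/-- The position after `k` leapfrog steps. -/
def leapfrogPos {d : ℕ} (f : Vec d → ℝ) (η : ℝ) (q p : Vec d) (k : ℕ) : Vec d :=
  (leapfrog f η k (q, p)).1

/-- The half-step velocity with which the `k`-th leapfrog position is left. -/
def leapfrogVel {d : ℕ} (f : Vec d → ℝ) (η : ℝ) (q p : Vec d) (k : ℕ) : Vec d :=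
  (leapfrog f η k (q, p)).2 - (η / 2) • gradient f (leapfrog f η k (q, p)).1

section Recursion

variable {d : ℕ} (f : Vec d → ℝ) (η : ℝ) (q p : Vec d)

theorem leapfrogPos_zero : leapfrogPos f η q p 0 = q := rfl

theorem leapfrogVel_zero : leapfrogVel f η q p 0 = p - (η / 2) • gradient f q := rfl

theorem leapfrogPos_succ (k : ℕ) :
    leapfrogPos f η q p (k + 1) = leapfrogPos f η q p k + η • leapfrogVel f η q p k := by
  rw [leapfrogPos, leapfrog, Function.iterate_succ_apply']; rfl

/-- The half kicks that end one step and begin the next use the same gradient and merge into a full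
kick. -/
theorem leapfrogVel_succ (k : ℕ) : leapfrogVel f η q p (k + 1) =
    leapfrogVel f η q p k - η • gradient f (leapfrogPos f η q p (k + 1)) := by
  have h : leapfrogVel f η q p (k + 1) =
      leapfrogVel f η q p k - (η / 2) • gradient f (leapfrogPos f η q p (k + 1)) -
        (η / 2) • gradient f (leapfrogPos f η q p (k + 1)) := by
    simp only [leapfrogPos, leapfrogVel, leapfrog, Function.iterate_succ_apply']; rfl
  rw [h]; module

variable {f}

theorem differentiable_leapfrog (hf : Differentiable ℝ (fderiv ℝ f)) (k : ℕ) :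
    Differentiable ℝ (fun p => leapfrogPos f η q p k) ∧
      Differentiable ℝ (fun p => leapfrogVel f η q p k) := by
  have hg : Differentiable ℝ (gradient f) := fun x => (hasFDerivAt_gradient hf x).differentiableAt
  induction k with
  | zero =>
    simp only [leapfrogPos_zero, leapfrogVel_zero]
    exact ⟨differentiable_const _, differentiable_id.sub_const _⟩
  | succ k ih =>
    have h : Differentiable ℝ (fun p => leapfrogPos f η q p (k + 1)) := by
      simp only [leapfrogPos_succ]
      exact ih.1.add (ih.2.const_smul η)
    refine ⟨h, ?_⟩
    simp only [leapfrogVel_succ]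
    exact ih.2.sub ((hg.comp h).const_smul η)

theorem fderiv_leapfrogPos_zero : fderiv ℝ (fun p => leapfrogPos f η q p 0) p = 0 := by
  simp only [leapfrogPos_zero]; exact (hasFDerivAt_const q p).fderiv

theorem fderiv_leapfrogVel_zero : fderiv ℝ (fun p => leapfrogVel f η q p 0) p = 1 := by
  simp only [leapfrogVel_zero]; exact ((hasFDerivAt_id p).sub_const _).fderiv

theorem fderiv_leapfrogPos_succ (hf : Differentiable ℝ (fderiv ℝ f)) (k : ℕ) :
    fderiv ℝ (fun p => leapfrogPos f η q p (k + 1)) p =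
      fderiv ℝ (fun p => leapfrogPos f η q p k) p +
        η • fderiv ℝ (fun p => leapfrogVel f η q p k) p := by
  simp only [leapfrogPos_succ]
  have h := differentiable_leapfrog η q hf k
  exact ((h.1 p).hasFDerivAt.add ((h.2 p).hasFDerivAt.const_smul η)).fderiv

theorem fderiv_leapfrogVel_succ (hf : Differentiable ℝ (fderiv ℝ f)) (k : ℕ) :
    fderiv ℝ (fun p => leapfrogVel f η q p (k + 1)) p =
      fderiv ℝ (fun p => leapfrogVel f η q p k) p -
        η • (hessian f (leapfrogPos f η q p (k + 1)) ∘L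
          fderiv ℝ (fun p => leapfrogPos f η q p (k + 1)) p) := by
  simp only [leapfrogVel_succ]
  have h := differentiable_leapfrog η q hf
  exact (((h k).2 p).hasFDerivAt.sub (((hasFDerivAt_gradient hf _).comp p
    ((h (k + 1)).1 p).hasFDerivAt).const_smul η)).fderiv

end Recursion

section Estimates

variable {d : ℕ} {f : Vec d → ℝ} {L η : ℝ} {K : ℕ}

theorem norm_leapfrogPos_sub_le (hL : 0 ≤ L) (hf : LSmooth L f) (hη : 0 ≤ η)
    (hstep : ((K : ℝ) * η) ^ 2 * L ≤ 1 / 16) (q q' p p' : Vec d) {k : ℕ} (hk : k ≤ K) :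
    ‖leapfrogPos f η q p k - leapfrogPos f η q' p' k - (q - q') - ((k : ℝ) * η) • (p - p')‖ ≤
      1 / 8 * (‖q - q'‖ + K * η * ‖p - p'‖) := by
  have := norm_leapfrog_recursion_le (K := K) (B := 0)
    (x := fun k => leapfrogPos f η q p k - leapfrogPos f η q' p' k)
    (v := fun k => leapfrogVel f η q p k - leapfrogVel f η q' p' k)
    (g := fun k => gradient f (leapfrogPos f η q p k) - gradient f (leapfrogPos f η q' p' k))
    (w := p - p') hη hL le_rfl hstep
    (fun k => by simp only [leapfrogPos_succ]; module)
    (by simp only [leapfrogVel_zero, leapfrogPos_zero]; module)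
    (fun k => by simp only [leapfrogVel_succ]; module)
    (fun k _ => by simpa using hf.norm_gradient_sub_le hL _ _) hk
  simpa only [leapfrogPos_zero, mul_zero, add_zero] using this

theorem norm_fderiv_leapfrogPos_sub_le (hL : 0 ≤ L) (hf : LSmooth L f) (hη : 0 ≤ η)
    (hstep : ((K : ℝ) * η) ^ 2 * L ≤ 1 / 16) (q p : Vec d) {k : ℕ} (hk : k ≤ K) :
    ‖fderiv ℝ (fun p => leapfrogPos f η q p k) p - ((k : ℝ) * η) • 1‖ ≤ 1 / 8 * (K * η) := by
  have hd := hf.differentiable_fderiv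
  have := norm_leapfrog_recursion_le (K := K) (B := 0)
    (x := fun k => fderiv ℝ (fun p => leapfrogPos f η q p k) p)
    (v := fun k => fderiv ℝ (fun p => leapfrogVel f η q p k) p)
    (g := fun k => hessian f (leapfrogPos f η q p k) ∘L
      fderiv ℝ (fun p => leapfrogPos f η q p k) p)
    (w := 1) hη hL le_rfl hstep
    (fun k => fderiv_leapfrogPos_succ η q p hd k)
    (by simp [fderiv_leapfrogVel_zero, fderiv_leapfrogPos_zero])
    (fun k => fderiv_leapfrogVel_succ η q p hd k)
    (fun k _ => by
      rw [add_zero]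
      refine (ContinuousLinearMap.opNorm_comp_le _ _).trans ?_
      gcongr
      exact hf.norm_hessian_le hL _) hk
  simp only [fderiv_leapfrogPos_zero, norm_zero, sub_zero, mul_zero, add_zero, zero_add] at this
  refine this.trans ?_
  have h1 : ‖(1 : Vec d →L[ℝ] Vec d)‖ ≤ 1 := ContinuousLinearMap.norm_id_le
  have h2 : 0 ≤ (K : ℝ) * η := by positivity
  nlinarith

theorem norm_fderiv_leapfrogPos_le (hL : 0 ≤ L) (hf : LSmooth L f) (hη : 0 ≤ η)
    (hstep : ((K : ℝ) * η) ^ 2 * L ≤ 1 / 16) (q p : Vec d) {k : ℕ} (hk : k ≤ K) :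
    ‖fderiv ℝ (fun p => leapfrogPos f η q p k) p‖ ≤ 9 / 8 * (K * η) := by
  have h1 := norm_fderiv_leapfrogPos_sub_le hL hf hη hstep q p hk
  have h2 : ‖((k : ℝ) * η) • (1 : Vec d →L[ℝ] Vec d)‖ ≤ K * η := by
    rw [norm_smul, Real.norm_of_nonneg (by positivity)]
    have h3 : ‖(1 : Vec d →L[ℝ] Vec d)‖ ≤ 1 := ContinuousLinearMap.norm_id_le
    calc (k : ℝ) * η * ‖(1 : Vec d →L[ℝ] Vec d)‖ ≤ K * η * 1 := by gcongr
      _ = K * η := mul_one _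
  have h3 := norm_add_le (fderiv ℝ (fun p => leapfrogPos f η q p k) p - ((k : ℝ) * η) • 1)
    (((k : ℝ) * η) • (1 : Vec d →L[ℝ] Vec d))
  rw [sub_add_cancel] at h3
  linarith

theorem norm_hsEntries_fderiv_leapfrogPos_sub_le {M : ℝ} (hM : 0 ≤ M) (hL : 0 ≤ L)
    (hf : LSmooth L f) (hf3 : StronglyHessianLipschitz M f) (hη : 0 ≤ η)
    (hstep : ((K : ℝ) * η) ^ 2 * L ≤ 1 / 16) (q q' p p' : Vec d) :
    ‖hsEntries (fderiv ℝ (fun p => leapfrogPos f η q p K) p -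
        fderiv ℝ (fun p => leapfrogPos f η q' p K) p')‖ ≤
      8 / 7 * ((K : ℝ) * η) ^ 2 *
        (M * (9 / 8 * (‖q - q'‖ + K * η * ‖p - p'‖)) * (9 / 8 * (K * η))) := by
  have hd := hf.differentiable_fderiv
  set D : Vec d → Vec d → ℕ → Vec d →L[ℝ] Vec d :=
    fun q p k => fderiv ℝ (fun p => leapfrogPos f η q p k) p with hD
  set V : Vec d → Vec d → ℕ → Vec d →L[ℝ] Vec d :=
    fun q p k => fderiv ℝ (fun p => leapfrogVel f η q p k) p with hV
  set H : Vec d → Vec d → ℕ → Vec d →L[ℝ] Vec d :=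
    fun q p k => hessian f (leapfrogPos f η q p k) with hH
  have hpos : ∀ k ≤ K, ‖leapfrogPos f η q p k - leapfrogPos f η q' p' k‖ ≤
      9 / 8 * (‖q - q'‖ + K * η * ‖p - p'‖) := fun k hk => by
    have h1 := norm_leapfrogPos_sub_le hL hf hη hstep q q' p p' hk
    set y := leapfrogPos f η q p k - leapfrogPos f η q' p' k
    have h2 : y = (y - (q - q') - ((k : ℝ) * η) • (p - p')) +
      ((q - q') + ((k : ℝ) * η) • (p - p')) := by abel
    have h3 : ‖(q - q') + ((k : ℝ) * η) • (p - p')‖ ≤ ‖q - q'‖ + K * η * ‖p - p'‖ := by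
      refine (norm_add_le _ _).trans ?_
      rw [norm_smul, Real.norm_of_nonneg (by positivity)]
      gcongr
    rw [h2]
    refine (norm_add_le _ _).trans ?_
    linarith
  have hg : ∀ k ≤ K, ‖hsEntries (H q p k ∘L D q p k - H q' p' k ∘L D q' p' k)‖ ≤
      L * ‖hsEntries (D q p k - D q' p' k)‖ +
        M * (9 / 8 * (‖q - q'‖ + K * η * ‖p - p'‖)) * (9 / 8 * (K * η)) := fun k hk => by
    -- The first summand is the linear feedback of the recursion; the second, the change of Hessian
    -- along the trajectories, is the forcing `B`.
    have h1 : H q p k ∘L D q p k - H q' p' k ∘L D q' p' k =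
        H q p k ∘L (D q p k - D q' p' k) + (H q p k - H q' p' k) ∘L D q' p' k := by
      rw [ContinuousLinearMap.comp_sub, ContinuousLinearMap.sub_comp]; abel
    rw [h1, map_add]
    refine (norm_add_le _ _).trans (add_le_add ?_ ?_)
    · refine (norm_hsEntries_comp_le _ _).trans ?_
      gcongr
      exact hf.norm_hessian_le hL _
    · refine (norm_hsEntries_comp_le' _ _).trans ?_
      have h2 : ‖hsEntries (H q p k - H q' p' k)‖ ≤
          M * (9 / 8 * (‖q - q'‖ + K * η * ‖p - p'‖)) :=
        (hf3.norm_hsEntries_hessian_sub_le _ _).trans (by gcongr; exact hpos k hk)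
      have h3 : ‖D q' p' k‖ ≤ 9 / 8 * (K * η) :=
        norm_fderiv_leapfrogPos_le hL hf hη hstep q' p' hk
      gcongr
  have hD0 : ∀ q p, D q p 0 = 0 := fun q p => fderiv_leapfrogPos_zero η q p
  have := norm_leapfrog_recursion_le (K := K)
    (x := fun k => hsEntries (D q p k - D q' p' k))
    (v := fun k => hsEntries (V q p k - V q' p' k))
    (g := fun k => hsEntries (H q p k ∘L D q p k - H q' p' k ∘L D q' p' k))
    (w := 0) hη hL (by positivity) hstep
    (fun k => by
      rw [← map_smul, ← map_add]
      congr 1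
      simp only [hD, hV, fderiv_leapfrogPos_succ η _ _ hd]
      module)
    (by simp only [hD0]; simp [hV, fderiv_leapfrogVel_zero])
    (fun k => by
      rw [← map_smul, ← map_sub]
      congr 1
      simp only [hD, hV, hH, fderiv_leapfrogVel_succ η _ _ hd]
      module)
    hg le_rfl
  simpa [hD0] using this

end Estimates


/-! ### Comparing two maps close to the same dilation. -/

/-- A map that is Lipschitz-close to a dilation is a homeomorphism. -/
theorem exists_homeomorph_of_norm_sub_smul_le {d : ℕ} {G : Vec d → Vec d} {τ : ℝ} (hτ : 0 < τ)
    (hG : ∀ p p', ‖G p - G p' - τ • (p - p')‖ ≤ 1 / 8 * (τ * ‖p - p'‖)) :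
    ∃ e : Vec d ≃ₜ Vec d, ∀ p, e p = G p := by
  let T : Vec d ≃L[ℝ] Vec d := ContinuousLinearEquiv.smulLeft (Units.mk0 τ hτ.ne')
  let c : NNReal := ⟨τ / 8, by positivity⟩
  have happ : ApproximatesLinearOn G (T : Vec d →L[ℝ] Vec d) Set.univ c :=
    fun x _ y _ => (hG x y).trans (le_of_eq (by change _ = τ / 8 * _; ring))
  refine ⟨happ.toHomeomorph G ?_, fun p => rfl⟩
  rcases subsingleton_or_nontrivial (Vec d) with h | h
  · exact Or.inl h
  right
  have hpos : 0 < ‖(T.symm : Vec d →L[ℝ] Vec d)‖₊ := T.nnnorm_symm_pos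
  have hle : ‖(T.symm : Vec d →L[ℝ] Vec d)‖ ≤ τ⁻¹ := by
    refine ContinuousLinearMap.opNorm_le_bound _ (by positivity) fun v => ?_
    change ‖((Units.mk0 τ hτ.ne')⁻¹ : ℝˣ) • v‖ ≤ _
    rw [Units.smul_def, norm_smul]
    simp [abs_of_pos hτ]
  rw [lt_inv_comm₀ (by change 0 < τ / 8; positivity) hpos]
  change ‖(T.symm : Vec d →L[ℝ] Vec d)‖ < (τ / 8)⁻¹
  refine hle.trans_lt ?_
  gcongr
  linarith

/-- A linear map close to a dilation is invertible, with a bound on the inverse. -/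
theorem exists_continuousLinearEquiv_of_norm_sub_smul_le {d : ℕ} {D : Vec d →L[ℝ] Vec d} {τ : ℝ}
    (hτ : 0 < τ) (hD : ‖D - τ • 1‖ ≤ 1 / 8 * τ) :
    ∃ e : Vec d ≃L[ℝ] Vec d, (e : Vec d →L[ℝ] Vec d) = D ∧
      ‖(e.symm : Vec d →L[ℝ] Vec d)‖ ≤ (7 / 8 * τ)⁻¹ := by
  have hlow : ∀ v, 7 / 8 * τ * ‖v‖ ≤ ‖D v‖ := fun v => by
    have h1 : ‖(D - τ • 1) v‖ ≤ 1 / 8 * τ * ‖v‖ := (ContinuousLinearMap.le_opNorm _ v).trans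
      (by gcongr)
    have h2 : τ • v = D v - (D - τ • 1) v := by simp
    have h3 : ‖τ • v‖ ≤ ‖D v‖ + ‖(D - τ • 1) v‖ := by rw [h2]; exact norm_sub_le _ _
    rw [norm_smul, Real.norm_of_nonneg hτ.le] at h3
    linarith
  have hinj : Function.Injective (D : Vec d →ₗ[ℝ] Vec d) := by
    rw [injective_iff_map_eq_zero]
    intro v hv
    have h1 := hlow v
    rw [show D v = 0 from hv, norm_zero] at h1
    exact norm_le_zero_iff.1 (nonpos_of_mul_nonpos_right h1 (by positivity))
  let e := (LinearEquiv.ofInjectiveEndo (D : Vec d →ₗ[ℝ] Vec d) hinj).toContinuousLinearEquiv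
  have he : ∀ v, e v = D v := fun v => rfl
  refine ⟨e, ContinuousLinearMap.ext he, ContinuousLinearMap.opNorm_le_bound _ (by positivity)
    fun v => ?_⟩
  have h1 := hlow (e.symm v)
  rw [← he, e.apply_symm_apply] at h1
  rw [inv_mul_eq_div, le_div_iff₀ (by positivity), mul_comm]
  exact h1

/-- Relative entropy between the images of the standard Gaussian under two maps that are close to
the same dilation and to each other. -/
theorem klDiv_stdGaussian_map_le {d : ℕ} {G H : Vec d → Vec d} {τ a b : ℝ} (hτ : 0 < τ)
    (hGd : Differentiable ℝ G) (hHd : Differentiable ℝ H)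
    (hG : ∀ p p', ‖G p - G p' - τ • (p - p')‖ ≤ 1 / 8 * (τ * ‖p - p'‖))
    (hH : ∀ p p', ‖H p - H p' - τ • (p - p')‖ ≤ 1 / 8 * (τ * ‖p - p'‖))
    (hGD : ∀ p, ‖fderiv ℝ G p - τ • 1‖ ≤ 1 / 8 * τ)
    (hHD : ∀ p, ‖fderiv ℝ H p - τ • 1‖ ≤ 1 / 8 * τ)
    (hGH : ∀ p, ‖G p - H p‖ ≤ 7 / 8 * τ * a)
    (hb : ∀ p p', ‖p - p'‖ ≤ a → ‖hsEntries (fderiv ℝ G p - fderiv ℝ H p')‖ ≤ 7 / 8 * τ * b) :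
    InformationTheory.klDiv ((ProbabilityTheory.stdGaussian (Vec d)).map G)
        ((ProbabilityTheory.stdGaussian (Vec d)).map H) ≤
      ENNReal.ofReal (a ^ 2 / 2 + 5 * b ^ 2) := by
  obtain ⟨eG, heG⟩ := exists_homeomorph_of_norm_sub_smul_le hτ hG
  obtain ⟨eH, heH⟩ := exists_homeomorph_of_norm_sub_smul_le hτ hH
  choose D hD hDsymm using fun p => exists_continuousLinearEquiv_of_norm_sub_smul_le hτ (hHD p)
  set Φ : Vec d → Vec d := fun p => eH.symm (G p) with hΦdef
  set Ψ : Vec d → Vec d := fun p => eG.symm (H p) with hΨdef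
  have hHΦ : ∀ p, H (Φ p) = G p := fun p => by rw [← heH, hΦdef, eH.apply_symm_apply]
  have hGΨ : ∀ p, G (Ψ p) = H p := fun p => by rw [← heG, hΨdef, eG.apply_symm_apply]
  have hΨ : Measurable Ψ := (eG.symm.continuous.comp hHd.continuous).measurable
  have hl : Function.LeftInverse Ψ Φ := fun p => by
    simp only [hΨdef, hHΦ]; rw [← heG, eG.symm_apply_apply]
  have hr : Function.RightInverse Ψ Φ := fun p => by
    simp only [hΦdef, hGΨ]; rw [← heH, eH.symm_apply_apply]
  have hmap : (ProbabilityTheory.stdGaussian (Vec d)).map H =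
      ((ProbabilityTheory.stdGaussian (Vec d)).map Ψ).map G := by
    rw [Measure.map_map hGd.continuous.measurable hΨ]
    congr 1
    exact funext fun p => (hGΨ p).symm
  have hinv : ∀ p, HasFDerivAt eH.symm ((D (Φ p)).symm : Vec d →L[ℝ] Vec d) (G p) := fun p => by
    refine HasFDerivAt.of_local_left_inverse (f := H) eH.symm.continuous.continuousAt ?_
      (Filter.Eventually.of_forall fun y => by rw [← heH, eH.apply_symm_apply])
    change HasFDerivAt H (D (Φ p) : Vec d →L[ℝ] Vec d) (Φ p)
    rw [hD]
    exact (hHd _).hasFDerivAt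
  have hΦ : ∀ p, HasFDerivAt Φ ((D (Φ p)).symm ∘L fderiv ℝ G p) p := fun p =>
    (hinv p).comp p (hGd p).hasFDerivAt
  -- This form transfers both operator and Frobenius bounds on the Jacobian difference to `Φ' - 1`.
  have hsub : ∀ p, ((D (Φ p)).symm : Vec d →L[ℝ] Vec d) ∘L fderiv ℝ G p - 1 =
      ((D (Φ p)).symm : Vec d →L[ℝ] Vec d) ∘L (fderiv ℝ G p - fderiv ℝ H (Φ p)) := fun p => by
    rw [ContinuousLinearMap.comp_sub, ← hD (Φ p), ContinuousLinearEquiv.coe_symm_comp_coe]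
    rfl
  -- `H (Φ p) - H p = G p - H p`, and `H` expands distances by at least `7/8 * τ`.
  have ha : ∀ p, ‖Φ p - p‖ ≤ a := fun p => by
    have h1 := hH (Φ p) p
    rw [hHΦ] at h1
    have h2 : τ • (Φ p - p) = (G p - H p) - (G p - H p - τ • (Φ p - p)) := by abel
    have h3 : ‖τ • (Φ p - p)‖ ≤ ‖G p - H p‖ + ‖G p - H p - τ • (Φ p - p)‖ := by
      conv_lhs => rw [h2]
      exact norm_sub_le _ _
    rw [norm_smul, Real.norm_of_nonneg hτ.le] at h3
    have h4 := hGH p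
    have h5 : 7 / 8 * τ * ‖Φ p - p‖ ≤ 7 / 8 * τ * a := by linarith
    exact le_of_mul_le_mul_left h5 (by positivity)
  rw [hmap]
  refine (InformationTheory.klDiv_map_le _ _ hGd.continuous.measurable).trans
    (klDiv_stdGaussian_map_inverse_le hΨ hl hr hΦ ha (fun p => ?_) fun p => ?_)
  · rw [hsub]
    have h1 : ‖fderiv ℝ G p - fderiv ℝ H (Φ p)‖ ≤ 1 / 4 * τ := by
      have h2 : fderiv ℝ G p - fderiv ℝ H (Φ p) =
        (fderiv ℝ G p - τ • 1) - (fderiv ℝ H (Φ p) - τ • 1) := by abel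
      rw [h2]
      refine (norm_sub_le _ _).trans ?_
      linarith [hGD p, hHD (Φ p)]
    calc _ ≤ (7 / 8 * τ)⁻¹ * (1 / 4 * τ) := (ContinuousLinearMap.opNorm_comp_le _ _).trans
          (mul_le_mul (hDsymm _) h1 (norm_nonneg _) (by positivity))
      _ = 2 / 7 := by field_simp; norm_num
  · rw [hsub]
    have h1 := hb p (Φ p) (by rw [norm_sub_rev]; exact ha p)
    calc _ ≤ (7 / 8 * τ)⁻¹ * (7 / 8 * τ * b) := (norm_hsEntries_comp_le _ _).trans
          (mul_le_mul (hDsymm _) h1 (norm_nonneg _) (by positivity))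
      _ = b := inv_mul_cancel_left₀ (by positivity) b

end

/-! ### Assembly and numerical constants. -/

theorem lemma1 (d : ℕ) (f : Vec d → ℝ) (L γ : ℝ) (hL : 0 ≤ L)
    (hsmooth : LSmooth L f)
    (hhess : StronglyHessianLipschitz (γ * L ^ (3 / 2 : ℝ)) f)
    (K : ℕ) (hK : 1 ≤ K) (η : ℝ) (hη : 0 < η)
    (hstep : (K : ℝ) * η * L ^ (1 / 2 : ℝ) ≤ 1 / 4)
    (q₀ q₀' : Vec d) (hq : ‖q₀ - q₀'‖ ≤ (1 / 64) * ((K : ℝ) * η)) :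
    InformationTheory.klDiv (hmcProposal f η K q₀) (hmcProposal f η K q₀') ≤
        ENNReal.ofReal (1 / 64 + (1 / 4) * ((K : ℝ) ^ 6 * η ^ 6 * γ ^ 2 * L ^ 3)) ∧
      tvDist (hmcProposal f η K q₀) (hmcProposal f η K q₀') ≤
        Real.sqrt (1 / 32 + (1 / 2) * ((K : ℝ) ^ 6 * η ^ 6 * γ ^ 2 * L ^ 3)) := by
  set M := γ * L ^ (3 / 2 : ℝ) with hMdef
  have hM2 : M ^ 2 = γ ^ 2 * L ^ 3 := by
    rw [hMdef, mul_pow, ← Real.rpow_mul_natCast hL]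
    norm_num
  -- `γ` may be negative, but the supremum bounded by `M` includes the value `0`.
  have hM : 0 ≤ M := (le_csSup (pairSingleValues_bddAbove (thirdDerivTensor f 0))
    ⟨0, 0, by simp, by simp, by simp⟩).trans (hhess.norm_le 0)
  have hτ : 0 < (K : ℝ) * η := mul_pos (by exact_mod_cast hK) hη
  have hstep2 : ((K : ℝ) * η) ^ 2 * L ≤ 1 / 16 := by
    have h1 : (L ^ (1 / 2 : ℝ)) ^ 2 = L := by
      rw [← Real.rpow_mul_natCast hL]; norm_num
    have h2 := pow_le_pow_left₀ (by positivity) hstep 2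
    rw [mul_pow, h1] at h2
    linarith
  have hX : (K : ℝ) ^ 6 * η ^ 6 * γ ^ 2 * L ^ 3 = (M * ((K : ℝ) * η) ^ 3) ^ 2 := by
    rw [mul_pow, hM2]; ring
  rw [hX]
  have hdiff : ∀ q, Differentiable ℝ fun p => leapfrogPos f η q p K := fun q =>
    (differentiable_leapfrog η q hsmooth.differentiable_fderiv K).1
  set τ := (K : ℝ) * η with hτdef
  have hmom : ∀ q p p', ‖leapfrogPos f η q p K - leapfrogPos f η q p' K - τ • (p - p')‖ ≤
      1 / 8 * (τ * ‖p - p'‖) := fun q p p' => by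
    simpa using norm_leapfrogPos_sub_le hL hsmooth hη.le hstep2 q q p p' le_rfl
  -- `a = 9/448` solves `9/8 * (τ/64) = 7/8 * τ * a`. Then `‖q₀ - q₀'‖ + τ a ≤ τ/28`, and `3/50`
  -- rounds up the resulting coefficient `81/1568` divided by `7/8`.
  have hkl : InformationTheory.klDiv (hmcProposal f η K q₀) (hmcProposal f η K q₀') ≤
      ENNReal.ofReal ((9 / 448) ^ 2 / 2 + 5 * (3 / 50 * (M * τ ^ 3)) ^ 2) := by
    refine klDiv_stdGaussian_map_le hτ (hdiff q₀) (hdiff q₀') (hmom q₀) (hmom q₀')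
      (fun p => norm_fderiv_leapfrogPos_sub_le hL hsmooth hη.le hstep2 q₀ p le_rfl)
      (fun p => norm_fderiv_leapfrogPos_sub_le hL hsmooth hη.le hstep2 q₀' p le_rfl)
      (fun p => ?_) fun p p' hp => ?_
    · have h1 := norm_leapfrogPos_sub_le hL hsmooth hη.le hstep2 q₀ q₀' p p le_rfl
      simp only [sub_self, smul_zero, sub_zero, norm_zero, mul_zero, add_zero] at h1
      have h2 := norm_le_norm_add_norm_sub' (leapfrogPos f η q₀ p K - leapfrogPos f η q₀' p K)
        (q₀ - q₀')
      change ‖leapfrogPos f η q₀ p K - leapfrogPos f η q₀' p K‖ ≤ _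
      linarith
    · refine (norm_hsEntries_fderiv_leapfrogPos_sub_le hM hL hsmooth hhess hη.le hstep2
        q₀ q₀' p p').trans ?_
      rw [← hτdef]
      have h1 : ‖q₀ - q₀'‖ + τ * ‖p - p'‖ ≤ 1 / 28 * τ := by
        have : τ * ‖p - p'‖ ≤ τ * (9 / 448) := by gcongr
        linarith
      calc _ ≤ 8 / 7 * τ ^ 2 * (M * (9 / 8 * (1 / 28 * τ)) * (9 / 8 * τ)) := by gcongr
        _ = (8 / 7 * (9 / 8) * (1 / 28) * (9 / 8)) * (τ * (M * τ ^ 3)) := by ring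
        _ ≤ (7 / 8 * (3 / 50)) * (τ * (M * τ ^ 3)) :=
            mul_le_mul_of_nonneg_right (by norm_num) (by positivity)
        _ = _ := by ring
  set X := (M * τ ^ 3) ^ 2 with hXdef
  have hX0 : 0 ≤ X := sq_nonneg _
  -- Chosen so that `4 * (1/128 + X/8)` is exactly the total variation radicand.
  have hcoef : (9 / 448) ^ 2 / 2 + 5 * (3 / 50 * (M * τ ^ 3)) ^ 2 ≤ 1 / 128 + 1 / 8 * X := by
    rw [mul_pow, ← hXdef]; linarith
  refine ⟨hkl.trans (ENNReal.ofReal_le_ofReal (by linarith)), ?_⟩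
  have hprob : ∀ q, IsProbabilityMeasure (hmcProposal f η K q) := fun q =>
    Measure.isProbabilityMeasure_map (hdiff q).continuous.measurable.aemeasurable
  refine (tvDist_le_sqrt_of_klDiv_le (by positivity) (hkl.trans (ENNReal.ofReal_le_ofReal hcoef))).trans
    (Real.sqrt_le_sqrt ?_)
  linarith
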